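/- A finite simple graph with $n$ vertices and $m$ edges is a \emph{Laman graph} if $m=2n-3$ and every set of $k\ge 2$ vertices spans at most $2k-3$ edges. A \emph{plane graph} is a finite connected simple graph $G=(V,E)$ with at least one edge, given with a cyclic (counter-clockwise) order of the incident edges around each vertex such that the resulting set $F$ of faces satisfies $|V|-|E|+|F|=2$ (an embedding in the sphere), and with one of the faces, $f_o$, chosen as the outer face. The degree $d_f$ of a face $f$ is the number of edges on its boundary walk (an edge with $f$ on both sides counts twice). An \emph{angle} is an ordered pair of consecutive edges at a vertex $v$; it is incident to $v$ and to the face between these two edges. A \emph{combinatorial pseudo-triangulation} of a plane graph is a labelling of its angles by \emph{big} and \emph{small} such that (i) every face other than $f_o$ has exactly three small angles; (ii) all angles of $f_o$ are big; (iii) every vertex is incident to at most one big angle; (iv) every vertex of degree $1$ or $2$ is incident to a big angle. It is \emph{pointed} if every vertex is incident to a big angle. The bipartite graph $H$ associated with a plane graph $G$ has the vertex classes $V$ and $W$, where $W$ consists of $d_f-3$ copies of each interior face $f\neq f_o$ and $h=d_{f_o}$ copies of the outer face $f_o$; a vertex $v\in V$ is adjacent in $H$ to all the copies of every face on whose boundary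 it lies. \textbf{Theorem.} Let $G$ be a plane Laman graph, with any choice of the outer face. Then $H$ satisfies Hall's condition, that is, every $A\subseteq V$ has at least $|A|$ neighbours in $W$; and $H$ has a perfect matching (one that covers all of $V$ and all of $W$). Hence $G$ has a pointed combinatorial pseudo-triangulation. -/

import Mathlib

/-- A rotation system of a simple graph: for every vertex, a cyclic order (thought of as the
counter-clockwise one) of the edges at this vertex. A dart is an edge together with one of its
endpoints, `d.fst`; `next d` is the dart that follows `d` around `d.fst`. -/
structure RotationSystem {V : Type*} (G : SimpleGraph V) where
  next : Equiv.Perm G.Dart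
  fst_next : ∀ d, (next d).fst = d.fst
  sameCycle_next : ∀ d e : G.Dart, d.fst = e.fst → next.SameCycle d e

namespace RotationSystem

variable {V : Type*} {G : SimpleGraph V} (R : RotationSystem G)

/-- One step along the boundary of the face to the left of a dart: from the dart `u → v` to the
dart at `v` that precedes `v → u` in the counter-clockwise order around `v`. -/
def facePerm : Equiv.Perm G.Dart :=
  (SimpleGraph.Dart.symm_involutive.toPerm SimpleGraph.Dart.symm).trans R.next.symm

/-- The faces are the orbits of the face-tracing permutation. -/
def Face : Type _ := Quotient (Equiv.Perm.SameCycle.setoid R.facePerm)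

/-- The face to the left of a dart. -/
def leftFace (d : G.Dart) : R.Face := Quotient.mk (Equiv.Perm.SameCycle.setoid R.facePerm) d

/-- The degree of a face: the number of edges on its boundary walk
(an edge with the face on both sides counts twice). -/
noncomputable def faceDegree (f : R.Face) : ℕ := {d : G.Dart | R.leftFace d = f}.ncard

/-- The vertex `v` lies on the face `f`. -/
def OnFace (v : V) (f : R.Face) : Prop := ∃ d : G.Dart, d.fst = v ∧ R.leftFace d = f

end RotationSystem

/-- A plane graph with at least one edge: a connected graph with a rotation system of genus zero
(`|V| - |E| + |F| = 2`), which is an embedding in the sphere, and one of the faces chosen as the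
outer face. -/
structure PlaneGraph {V : Type*} (G : SimpleGraph V) extends RotationSystem G where
  connected : G.Connected
  euler : Nat.card V + Nat.card toRotationSystem.Face = G.edgeSet.ncard + 2
  outer : toRotationSystem.Face

/-- A (finite) graph on `n` vertices is a Laman graph if it has exactly `2 n - 3` edges and every
set of `k ≥ 2` vertices spans at most `2 k - 3` edges. -/
def IsLaman {V : Type*} (G : SimpleGraph V) : Prop :=
  G.edgeSet.ncard + 3 = 2 * Nat.card V ∧
    ∀ s : Finset V, 2 ≤ s.card → {e ∈ G.edgeSet | ∀ v ∈ e, v ∈ s}.ncard + 3 ≤ 2 * s.card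

namespace PlaneGraph

variable {V : Type*} {G : SimpleGraph V} (P : PlaneGraph G)

/-- An angle is a pair of consecutive edges at a vertex; the dart `d` stands for the angle between
`d` and `P.next d`. (The two angles at a vertex of degree 2 are thus kept apart.) -/
abbrev Angle (_P : PlaneGraph G) : Type _ := G.Dart

variable {P} in
/-- The vertex of an angle. -/
def Angle.vertex (a : P.Angle) : V := a.toProd.1

variable {P} in
/-- The face that contains an angle: the face to the left of its first dart. -/
def Angle.face (a : P.Angle) : P.Face := P.leftFace a

/-- A combinatorial pseudo-triangulation: `Big` is the set of angles labelled big, all other angles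
are labelled small. -/
structure IsCPT (Big : Set P.Angle) : Prop where
  /-- Every interior face has exactly three small angles. -/
  three_corners : ∀ f : P.Face, f ≠ P.outer → {a : P.Angle | a.face = f ∧ a ∉ Big}.ncard = 3
  /-- All angles of the outer face are big. -/
  outer_big : ∀ a : P.Angle, a.face = P.outer → a ∈ Big
  /-- Every vertex is incident to at most one big angle. -/
  at_most_one : ∀ a ∈ Big, ∀ b ∈ Big, Angle.vertex a = Angle.vertex b → a = b
  /-- A vertex of degree 2 is incident to a big angle. -/
  degree_two : ∀ v : V, (G.neighborSet v).ncard = 2 → ∃ a ∈ Big, Angle.vertex a = v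
  /-- The only angle at a vertex of degree 1 is big. -/
  degree_one : ∀ v : V, (G.neighborSet v).ncard = 1 → ∃ a ∈ Big, Angle.vertex a = v

/-- A pointed combinatorial pseudo-triangulation: every vertex is incident to a big angle. -/
structure IsPointedCPT (Big : Set P.Angle) : Prop extends P.IsCPT Big where
  pointed : ∀ v : V, ∃ a ∈ Big, Angle.vertex a = v

open Classical in
/-- The number of copies of a face `f`: its degree if `f` is the outer face, and its degree minus 3
otherwise. (An interior face has degree at least 3, see `three_le_faceDegree`.) -/
noncomputable def multiplicity (f : P.Face) : ℕ :=
  if f = P.outer then P.faceDegree f else P.faceDegree f - 3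

/-- The faces, taken with multiplicities. -/
def FaceCopy : Type _ := Σ f : P.Face, Fin (P.multiplicity f)

/-- The associated bipartite graph: a vertex is joined to all copies of the faces on which it
lies. -/
def bipartiteGraph : SimpleGraph (V ⊕ P.FaceCopy) where
  Adj
    | Sum.inl v, Sum.inr w => P.OnFace v w.1
    | Sum.inr w, Sum.inl v => P.OnFace v w.1
    | _, _ => False
  symm := ⟨by rintro (v | w) (v' | w') h <;> exact h⟩
  loopless := ⟨by rintro (v | w) h <;> exact h⟩

/-- Hall's condition for the side `V` of the associated bipartite graph: every set `A` of vertices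
has at least `|A|` neighbours. -/
def HallCondition : Prop :=
  ∀ A : Set V,
    A.ncard ≤ {w : P.FaceCopy | ∃ v ∈ A, P.bipartiteGraph.Adj (Sum.inl v) (Sum.inr w)}.ncard

/-- Interior faces have degree at least 3, so the subtraction in `multiplicity` never truncates. -/
theorem three_le_faceDegree [Finite V] (f : P.Face) (hf : f ≠ P.outer) :
    3 ≤ P.faceDegree f := by
  have hfin : Finite G.Dart := Finite.of_injective _ SimpleGraph.Dart.toProd_injective
  obtain ⟨d, rfl⟩ : ∃ d, P.leftFace d = f := Quotient.exists_rep f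
  have hstep : ∀ e, (P.facePerm e).fst = e.snd := by
    intro e
    have h := P.fst_next (P.next.symm e.symm)
    rw [Equiv.apply_symm_apply] at h
    exact h.symm
  have hface : ∀ e, P.leftFace (P.facePerm e) = P.leftFace e := by
    intro e
    exact Quotient.sound (s := Equiv.Perm.SameCycle.setoid P.facePerm)
      (Equiv.Perm.sameCycle_apply_left.2 (Equiv.Perm.SameCycle.refl _ _))
  have h1 : ∀ e, P.facePerm e ≠ e := by
    intro e h
    have h2 := hstep e
    rw [h] at h2
    exact e.adj.ne h2
  by_cases h2 : P.facePerm (P.facePerm d) = d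
  · exfalso
    have hsymm : P.facePerm d = d.symm := by
      have h3 := hstep (P.facePerm d)
      rw [h2] at h3
      exact SimpleGraph.Dart.ext _ _ (Prod.ext (hstep d) h3.symm)
    have hfix1 : P.next d.symm = d.symm := by
      have h3 : P.next.symm d.symm = d.symm := hsymm
      conv_lhs => rw [← h3]
      simp
    have hfix2 : P.next d = d := by
      have h3 : P.next.symm d.symm.symm = d := by rw [← hsymm]; exact h2
      rw [SimpleGraph.Dart.symm_symm] at h3
      conv_lhs => rw [← h3]
      simp
    have hd1 : ∀ e : G.Dart, e.fst = d.fst → e = d := by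
      intro e he
      obtain ⟨i, hi⟩ := P.sameCycle_next d e he.symm
      rw [Equiv.Perm.zpow_apply_eq_self_of_apply_eq_self hfix2] at hi
      exact hi.symm
    have hd2 : ∀ e : G.Dart, e.fst = d.snd → e = d.symm := by
      intro e he
      obtain ⟨i, hi⟩ := P.sameCycle_next d.symm e he.symm
      rw [Equiv.Perm.zpow_apply_eq_self_of_apply_eq_self hfix1] at hi
      exact hi.symm
    have hV : ∀ w, w = d.fst ∨ w = d.snd := by
      intro w
      have hr := P.connected.preconnected d.fst w
      rw [SimpleGraph.reachable_iff_reflTransGen] at hr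
      induction hr with
      | refl => exact Or.inl rfl
      | @tail b c _ hbc ih =>
        rcases ih with hb | hb
        · have h3 := hd1 ⟨(b, c), hbc⟩ hb
          exact Or.inr (congrArg (fun e : G.Dart => e.snd) h3)
        · have h3 := hd2 ⟨(b, c), hbc⟩ hb
          exact Or.inl (congrArg (fun e : G.Dart => e.snd) h3)
    apply hf
    obtain ⟨e, he⟩ : ∃ e, P.leftFace e = P.outer := Quotient.exists_rep P.outer
    rw [← he]
    rcases hV e.fst with h3 | h3
    · rw [hd1 e h3]
    · rw [hd2 e h3, ← hsymm, hface]
  · have hsub : ({d, P.facePerm d, P.facePerm (P.facePerm d)} : Set G.Dart) ⊆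
        {e | P.leftFace e = P.leftFace d} := by
      rintro e (rfl | rfl | rfl)
      · exact rfl
      · exact hface _
      · exact (hface _).trans (hface _)
    have hcard : ({d, P.facePerm d, P.facePerm (P.facePerm d)} : Set G.Dart).ncard = 3 :=
      Set.ncard_eq_three.2 ⟨_, _, _, (h1 d).symm, fun h => h2 h.symm,
        (h1 (P.facePerm d)).symm, rfl⟩
    rw [← hcard]
    exact Set.ncard_le_ncard hsub (Set.toFinite _)

end PlaneGraph

/-! Hall's condition for `A` is proved with `T`, the faces around `A`, and the possibly larger set
`B` of vertices all of whose faces lie in `T`. If `A` splits into two parts with disjoint face sets,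
induction applies; otherwise `T` is dually connected. If `B` is everything, Euler's formula and the
edge count give equality (`sum_multiplicity`).

Otherwise let `i` edges have both sides in `T`, `b` edges exactly one side, and let `U` be the
vertices on faces of `T`. The multiplicities over `T` sum to at least `2i + b - 3|T|`. The Laman
bound `i + b ≤ 2|U| - 3` and `|U| ≤ |B| + b` give `b ≥ i + 3 - 2|B|`. With `i ≥ |T| + |B| - 1`
(`two_mul_card_add_card_le`) the sum is at least `3(i + 1 - |T|) - 2|B| ≥ |B|`.

The bound on `i` needs no topology beyond the orthogonality of primal and dual coboundaries.
Finally, Hall's theorem and equal cardinalities give a bijection, and each vertex makes big an angle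
in the face assigned to it. -/

open scoped Finset

/-- A symmetric set of darts has twice as many elements as the set of its edges. -/
theorem SimpleGraph.card_darts_eq_two_mul_card_image_edge {V : Type*} [Fintype V] [DecidableEq V]
    {G : SimpleGraph V} [Fintype G.Dart] (S : Finset G.Dart) (hS : ∀ d ∈ S, d.symm ∈ S) :
    #S = 2 * #(S.image SimpleGraph.Dart.edge) := by
  classical
  rw [Finset.card_eq_sum_card_image SimpleGraph.Dart.edge S, Finset.sum_const_nat (m := 2), mul_comm]
  intro e he
  obtain ⟨d, hd, rfl⟩ := Finset.mem_image.1 he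
  have h : S.filter (fun a => a.edge = d.edge) = {d, d.symm} := by
    ext a
    simp only [Finset.mem_filter, Finset.mem_insert, Finset.mem_singleton,
      SimpleGraph.dart_edge_eq_iff]
    constructor
    · exact fun h => h.2
    · rintro (rfl | rfl)
      · exact ⟨hd, Or.inl rfl⟩
      · exact ⟨hS _ hd, Or.inr rfl⟩
  rw [h, Finset.card_pair d.symm_ne.symm]

/-! ### Rotation systems: face tracing, coboundaries and the bound on inner edges. -/

namespace RotationSystem

variable {V : Type*} {G : SimpleGraph V} (R : RotationSystem G)

theorem fst_symm_next (d : G.Dart) : (R.next.symm d).fst = d.fst := by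
  conv_rhs => rw [← R.next.apply_symm_apply d, R.fst_next]

theorem fst_facePerm (d : G.Dart) : (R.facePerm d).fst = d.snd :=
  R.fst_symm_next d.symm

theorem leftFace_facePerm (d : G.Dart) : R.leftFace (R.facePerm d) = R.leftFace d :=
  Quotient.sound (s := Equiv.Perm.SameCycle.setoid R.facePerm)
    (Equiv.Perm.sameCycle_apply_left.2 (Equiv.Perm.SameCycle.refl _ _))

/-- The face to the right of a dart is to the left of the preceding dart at the same vertex. -/
theorem leftFace_symm (d : G.Dart) : R.leftFace d.symm = R.leftFace (R.next.symm d) :=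
  (R.leftFace_facePerm d.symm).symm

theorem exists_leftFace (f : R.Face) : ∃ d, R.leftFace d = f :=
  Quotient.exists_rep f

/-- If a property of the darts at a vertex does not hold for all of them, it fails first somewhere:
it changes between two consecutive darts. -/
theorem exists_next_change [Finite V] (p : G.Dart → Prop) {d e : G.Dart} (hde : d.fst = e.fst)
    (hd : p d) (he : ¬ p e) : ∃ a : G.Dart, a.fst = d.fst ∧ p a ∧ ¬ p (R.next.symm a) := by
  have hfin : Finite G.Dart := Finite.of_injective _ SimpleGraph.Dart.toProd_injective
  by_contra! h
  -- By finiteness, `d` is reached from `e` by forward steps only, and each step preserves `¬ p`.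
  obtain ⟨i, -, hi⟩ := (R.sameCycle_next e d hde.symm).exists_pow_eq'
  have key : ∀ i : ℕ, ((R.next ^ i) e).fst = d.fst ∧ ¬ p ((R.next ^ i) e) := by
    intro i
    induction i with
    | zero => exact ⟨hde.symm, he⟩
    | succ i ih =>
      rw [pow_succ', Equiv.Perm.mul_apply]
      have h1 := (R.fst_next ((R.next ^ i) e)).trans ih.1
      refine ⟨h1, fun h2 => ih.2 ?_⟩
      simpa using h _ h1 h2
  exact (key i).2 (hi ▸ hd)

/-- The coboundary of a function on the vertices and the dual coboundary of a function on the faces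
are orthogonal. -/
theorem sum_dual_coboundary_mul_coboundary [Fintype G.Dart] (f : R.Face → ℚ) (g : V → ℚ) :
    ∑ d : G.Dart, (f (R.leftFace d) - f (R.leftFace d.symm)) * (g d.fst - g d.snd) = 0 := by
  have h1 : ∑ d : G.Dart, (f (R.leftFace d) - f (R.leftFace d.symm)) * g d.snd
      = ∑ d : G.Dart, (f (R.leftFace d.symm) - f (R.leftFace d)) * g d.fst :=
    Fintype.sum_equiv (SimpleGraph.Dart.symm_involutive.toPerm SimpleGraph.Dart.symm) _ _
      fun d => by simp
  -- Rotating by one dart around each vertex turns right faces into left faces.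
  have h2 : ∑ d : G.Dart, f (R.leftFace d.symm) * g d.fst
      = ∑ d : G.Dart, f (R.leftFace d) * g d.fst :=
    Fintype.sum_equiv R.next.symm _ _ fun d => by rw [R.leftFace_symm, R.fst_symm_next]
  simp only [mul_sub, Finset.sum_sub_distrib, h1]
  simp only [sub_mul, Finset.sum_sub_distrib, h2]
  ring

open Classical in
/-- Let `T` be a set of faces that is connected in the dual graph, and let all faces around the
vertices in `B` belong to `T`. The number of edges with both sides in `T` (here: half of the number
of darts) is at least `|T| + |B| - 1`. -/
theorem two_mul_card_add_card_le [Fintype V] (hG : G.Connected) (T : Finset R.Face)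
    (B : Finset V) (hB : ∀ d : G.Dart, d.fst ∈ B → R.leftFace d ∈ T) (hBV : ∃ v, v ∉ B)
    (t₀ : R.Face) (hconn : ∀ f : R.Face → ℚ,
      (∀ d : G.Dart, R.leftFace d ∈ T → R.leftFace d.symm ∈ T →
        f (R.leftFace d) = f (R.leftFace d.symm)) → ∀ t ∈ T, f t = f t₀) :
    2 * (#T + #B) ≤ #{d : G.Dart | R.leftFace d ∈ T ∧ R.leftFace d.symm ∈ T} + 2 := by
  set D : Finset G.Dart := {d : G.Dart | R.leftFace d ∈ T ∧ R.leftFace d.symm ∈ T} with hD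
  have hDmem : ∀ d, d ∈ D ↔ R.leftFace d ∈ T ∧ R.leftFace d.symm ∈ T := by simp [hD]
  have hDsymm : ∀ d ∈ D, d.symm ∈ D := by
    intro d hd
    rw [hDmem] at hd ⊢
    exact ⟨hd.2, hd.1⟩
  rw [SimpleGraph.card_darts_eq_two_mul_card_image_edge D hDsymm]
  set E := D.image SimpleGraph.Dart.edge
  have hsec : ∀ e : E, ∃ d : G.Dart, d.edge = e := fun e =>
    (Finset.mem_image.1 e.2).imp fun _ h => h.2
  choose σ hσ using hsec
  let F := Function.ExtendByZero.linearMap ℚ (Subtype.val : T → R.Face)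
  let H := Function.ExtendByZero.linearMap ℚ (Subtype.val : B → V)
  -- Injectivity of this map gives `|T| + |B| ≤ |E| + 1`. The last coordinate removes the constants,
  -- the only kernel of the dual coboundary on a dually connected `T`.
  let Φ : (T → ℚ) × (B → ℚ) →ₗ[ℚ] (E → ℚ) × ℚ :=
    { toFun := fun x => (fun e => F x.1 (R.leftFace (σ e)) - F x.1 (R.leftFace (σ e).symm)
        + (H x.2 (σ e).fst - H x.2 (σ e).snd), F x.1 t₀)
      map_add' := by
        intro x y
        ext <;> simp
        ring
      map_smul' := by
        intro c x
        ext <;> simp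
        ring }
  have hΦ : Function.Injective Φ := by
    rw [injective_iff_map_eq_zero]
    rintro ⟨f', g'⟩ h0
    obtain ⟨f, hf⟩ : ∃ f, f = F f' := ⟨_, rfl⟩
    obtain ⟨g, hg⟩ : ∃ g, g = H g' := ⟨_, rfl⟩
    have hfT : ∀ t : T, f t = f' t := fun t => by
      rw [hf]; exact Subtype.val_injective.extend_apply f' 0 t
    have hgB : ∀ v : B, g v = g' v := fun v => by
      rw [hg]; exact Subtype.val_injective.extend_apply g' 0 v
    have hgB' : ∀ v ∉ B, g v = 0 := fun v hv => by
      rw [hg]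
      exact Function.extend_apply' (f := (Subtype.val : B → V)) g' 0 v
        (by rintro ⟨a, rfl⟩; exact hv a.2)
    have hσ0 : ∀ e, f (R.leftFace (σ e)) - f (R.leftFace (σ e).symm)
        + (g (σ e).fst - g (σ e).snd) = 0 := by
      intro e
      rw [hf, hg]
      exact congrFun (congrArg Prod.fst h0) e
    have ht₀ : f t₀ = 0 := by
      rw [hf]
      exact congrArg Prod.snd h0
    have hD0 : ∀ d ∈ D, f (R.leftFace d) - f (R.leftFace d.symm) + (g d.fst - g d.snd) = 0 := by
      intro d hd
      have h1 := hσ0 ⟨d.edge, Finset.mem_image_of_mem _ hd⟩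
      have h2 := hσ ⟨d.edge, Finset.mem_image_of_mem _ hd⟩
      rcases (SimpleGraph.dart_edge_eq_iff _ _).1 h2 with h3 | h3
      · rwa [h3] at h1
      · rw [h3, SimpleGraph.Dart.symm_symm] at h1
        have h4 : d.symm.fst = d.snd := rfl
        have h5 : d.symm.snd = d.fst := rfl
        rw [h4, h5] at h1
        linarith
    -- An edge with an end in `B` has both sides in `T`, so outside `D` both ends carry the value 0.
    have hoff : ∀ d ∉ D, g d.fst - g d.snd = 0 := by
      intro d hd
      have h1 : d.fst ∉ B := fun h => hd <| (hDmem d).2 ⟨hB d h, by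
        rw [R.leftFace_symm]
        exact hB _ (by rwa [R.fst_symm_next])⟩
      have h2 : d.snd ∉ B := fun h => hd <| (hDmem d).2 ⟨by
        rw [← R.leftFace_facePerm]
        exact hB _ (by rwa [R.fst_facePerm]), hB d.symm h⟩
      rw [hgB' _ h1, hgB' _ h2, sub_zero]
    -- On `D` the two coboundaries are opposite, so their orthogonality forces the norm of that of
    -- `g` to vanish.
    have hsq : ∑ d : G.Dart, (g d.fst - g d.snd) * (g d.fst - g d.snd) = 0 := by
      have h1 := R.sum_dual_coboundary_mul_coboundary f g
      have h2 : ∑ d : G.Dart, (f (R.leftFace d) - f (R.leftFace d.symm)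
          + (g d.fst - g d.snd)) * (g d.fst - g d.snd) = 0 := by
        refine Finset.sum_eq_zero fun d _ => ?_
        by_cases hd : d ∈ D
        · rw [hD0 d hd, zero_mul]
        · rw [hoff d hd, mul_zero]
      simpa only [add_mul, Finset.sum_add_distrib, h1, zero_add] using h2
    have hgd : ∀ d : G.Dart, g d.fst = g d.snd := by
      intro d
      have h1 := (Finset.sum_eq_zero_iff_of_nonneg fun d _ => mul_self_nonneg _).1 hsq d
        (Finset.mem_univ d)
      exact sub_eq_zero.1 (mul_self_eq_zero.1 h1)
    obtain ⟨v₀, hv₀⟩ := hBV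
    have hg0 : ∀ v, g v = 0 := by
      intro v
      have hr := hG.preconnected v₀ v
      rw [SimpleGraph.reachable_iff_reflTransGen] at hr
      induction hr with
      | refl => exact hgB' _ hv₀
      | @tail b c _ hbc ih => exact (hgd ⟨(b, c), hbc⟩).symm.trans ih
    have hf0 := hconn f fun d h1 h2 => by
      have h3 := hD0 d ((hDmem d).2 ⟨h1, h2⟩)
      rw [hg0, hg0] at h3
      linarith
    ext t
    · exact (hfT t).symm.trans ((hf0 t t.2).trans ht₀)
    · exact (hgB t).symm.trans (hg0 t)
  have h := LinearMap.finrank_le_finrank_of_injective hΦ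
  simp only [Module.finrank_prod, Module.finrank_fintype_fun_eq_card, Fintype.card_coe,
    Module.finrank_self] at h
  omega

end RotationSystem

open Classical in
/-- The edge bound in the definition of a Laman graph, in terms of darts. -/
theorem IsLaman.card_darts_le {V : Type*} [Fintype V] {G : SimpleGraph V} (hG : IsLaman G)
    (U : Finset V) (hU : 2 ≤ #U) : #{d : G.Dart | d.fst ∈ U ∧ d.snd ∈ U} + 6 ≤ 4 * #U := by
  rw [SimpleGraph.card_darts_eq_two_mul_card_image_edge _ (by simp +contextual)]
  have h : (Finset.univ.filter fun d : G.Dart => d.fst ∈ U ∧ d.snd ∈ U).image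
      SimpleGraph.Dart.edge ⊆ {e ∈ G.edgeSet | ∀ v ∈ e, v ∈ U}.toFinset := by
    intro e he
    obtain ⟨d, hd, rfl⟩ := Finset.mem_image.1 he
    rw [Finset.mem_filter] at hd
    rw [Set.mem_toFinset]
    refine ⟨d.edge_mem, fun v hv => ?_⟩
    rcases Sym2.mem_iff.1 (show v ∈ s(d.fst, d.snd) from hv) with rfl | rfl
    · exact hd.2.1
    · exact hd.2.2
  have h1 := Finset.card_le_card h
  have h2 := hG.2 U hU
  rw [Set.ncard_eq_toFinset_card'] at h2
  omega

theorem IsLaman.nontrivial {V : Type*} [Finite V] {G : SimpleGraph V} (hG : IsLaman G) :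
    Nontrivial V := by
  have h := hG.1
  exact Finite.one_lt_card_iff_nontrivial.1 (by omega)

/-! ### Counting face copies and Hall's condition. -/

namespace PlaneGraph

variable {V : Type*} {G : SimpleGraph V} (P : PlaneGraph G)

theorem finite_face [Finite V] : Finite P.Face :=
  have : Finite G.Dart := Finite.of_injective _ SimpleGraph.Dart.toProd_injective
  Finite.of_surjective P.leftFace P.exists_leftFace

-- The additive form avoids truncated subtraction; the 3 for the outer face compensates for its full
-- multiplicity.
open Classical in
theorem multiplicity_add_three [Finite V] (f : P.Face) :
    P.multiplicity f + 3 = P.faceDegree f + if f = P.outer then 3 else 0 := by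
  unfold multiplicity
  split_ifs with h
  · rfl
  · have := P.three_le_faceDegree f h
    omega

open Classical in
theorem faceDegree_eq_card [Fintype V] (f : P.Face) :
    P.faceDegree f = #{d : G.Dart | P.leftFace d = f} := by
  rw [RotationSystem.faceDegree, Set.ncard_eq_toFinset_card', Set.toFinset_ofPred]

open Classical in
theorem sum_faceDegree [Fintype V] (T : Finset P.Face) :
    ∑ f ∈ T, P.faceDegree f = #{d : G.Dart | P.leftFace d ∈ T} := by
  rw [Finset.card_eq_sum_card_fiberwise (f := P.leftFace) (t := T) (fun d hd => by simpa using hd)]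
  refine Finset.sum_congr rfl fun f hf => ?_
  rw [P.faceDegree_eq_card, Finset.filter_filter]
  congr 1
  ext d
  simp only [Finset.mem_filter, Finset.mem_univ, true_and]
  exact ⟨fun h => ⟨h ▸ hf, h⟩, fun h => h.2⟩

open Classical in
theorem sum_multiplicity_add [Fintype V] (T : Finset P.Face) :
    ∑ f ∈ T, P.multiplicity f + 3 * #T =
      #{d : G.Dart | P.leftFace d ∈ T} + if P.outer ∈ T then 3 else 0 := by
  have h := Finset.sum_congr (rfl : T = T) fun f _ => P.multiplicity_add_three f
  rw [Finset.sum_add_distrib, Finset.sum_add_distrib, P.sum_faceDegree, Finset.sum_const,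
    Finset.sum_ite_eq', smul_eq_mul] at h
  omega

/-- In a plane Laman graph, the multiplicities of all faces add up to the number of vertices. -/
theorem sum_multiplicity [Fintype V] [Fintype P.Face] (hG : IsLaman G) :
    ∑ f, P.multiplicity f = Fintype.card V := by
  classical
  have h := P.sum_multiplicity_add Finset.univ
  have h1 : #{d : G.Dart | P.leftFace d ∈ Finset.univ} = Fintype.card G.Dart := by
    simp [Finset.card_univ]
  rw [h1, if_pos (Finset.mem_univ _), SimpleGraph.dart_card_eq_twice_card_edges,
    Finset.card_univ] at h
  have h2 := P.euler
  have h3 := hG.1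
  have h4 : G.edgeSet.ncard = #G.edgeFinset := by
    rw [Set.ncard_eq_toFinset_card']; rfl
  rw [Nat.card_eq_fintype_card, Nat.card_eq_fintype_card] at h2
  rw [Nat.card_eq_fintype_card] at h3
  -- With `n` vertices and `m` edges, the sum is `2m + 3 - 3(m + 2 - n) = 3n - m - 3`, which is `n`
  -- for `m = 2n - 3`.
  omega

open Classical in
/-- The faces around the vertices of a set. -/
noncomputable def facesAt [Fintype P.Face] (A : Finset V) : Finset P.Face :=
  {f | ∃ v ∈ A, P.OnFace v f}

theorem mem_facesAt [Fintype P.Face] {A : Finset V} {f : P.Face} :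
    f ∈ P.facesAt A ↔ ∃ v ∈ A, P.OnFace v f := by
  simp [facesAt]

open Classical in
/-- The main counting step: the vertices all of whose surrounding faces lie in a dually connected
set `T` of faces do not outnumber the copies of these faces. -/
theorem card_le_sum_multiplicity_of_dual_connected [Fintype V] (hG : IsLaman G)
    (T : Finset P.Face) (B : Finset V)
    (hB : ∀ v, v ∈ B ↔ ∀ d : G.Dart, d.fst = v → P.leftFace d ∈ T)
    (hBV : ∃ v, v ∉ B) (t₀ : P.Face) (ht₀ : t₀ ∈ T) (hconn : ∀ f : P.Face → ℚ,
      (∀ d : G.Dart, P.leftFace d ∈ T → P.leftFace d.symm ∈ T →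
        f (P.leftFace d) = f (P.leftFace d.symm)) → ∀ t ∈ T, f t = f t₀) :
    #B ≤ ∑ f ∈ T, P.multiplicity f := by
  have h1 := P.two_mul_card_add_card_le P.connected T B (fun d hd => (hB _).1 hd d rfl) hBV t₀ hconn
  have h2 := P.sum_multiplicity_add T
  set D : Finset G.Dart := {d | P.leftFace d ∈ T ∧ P.leftFace d.symm ∈ T} with hD
  set D₁ : Finset G.Dart := {d | P.leftFace d ∈ T ∧ P.leftFace d.symm ∉ T} with hD₁
  set D₂ : Finset G.Dart := {d | P.leftFace d ∉ T ∧ P.leftFace d.symm ∈ T} with hD₂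
  set U : Finset V := {v | ∃ d : G.Dart, d.fst = v ∧ P.leftFace d ∈ T} with hUdef
  have hfst : ∀ d : G.Dart, P.leftFace d ∈ T → d.fst ∈ U := fun d hd => by
    simp only [hUdef, Finset.mem_filter, Finset.mem_univ, true_and]
    exact ⟨d, rfl, hd⟩
  have hsnd : ∀ d : G.Dart, P.leftFace d ∈ T → d.snd ∈ U := fun d hd => by
    rw [← P.fst_facePerm]
    exact hfst _ (by rwa [P.leftFace_facePerm])
  have hT : #{d : G.Dart | P.leftFace d ∈ T} = #D + #D₁ := by
    rw [← Finset.card_filter_add_card_filter_not (fun d : G.Dart => P.leftFace d.symm ∈ T),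
      Finset.filter_filter, Finset.filter_filter]
  have h12 : #D₁ = #D₂ := by
    refine Finset.card_bij' (fun d _ => d.symm) (fun d _ => d.symm) ?_ ?_ ?_ ?_ <;>
      simp +contextual [hD₁, hD₂]
  have hU2 : 2 ≤ #U := by
    obtain ⟨d, rfl⟩ := P.exists_leftFace t₀
    rw [← Finset.card_pair d.adj.ne]
    refine Finset.card_le_card ?_
    rintro v hv
    rcases Finset.mem_insert.1 hv with rfl | hv
    · exact hfst d ht₀
    · exact Finset.mem_singleton.1 hv ▸ hsnd d ht₀
  have hlaman := hG.card_darts_le U hU2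
  have hDU : #D + #D₁ + #D₂ ≤ #{d : G.Dart | d.fst ∈ U ∧ d.snd ∈ U} := by
    rw [← Finset.card_union_of_disjoint, ← Finset.card_union_of_disjoint]
    · refine Finset.card_le_card fun d hd => ?_
      rw [Finset.mem_filter]
      refine ⟨Finset.mem_univ _, ?_⟩
      by_cases h : P.leftFace d ∈ T
      · exact ⟨hfst d h, hsnd d h⟩
      · have h' : P.leftFace d.symm ∈ T := by
          simp only [hD, hD₁, hD₂, Finset.mem_union, Finset.mem_filter] at hd
          tauto
        exact ⟨hsnd _ h', hfst _ h'⟩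
    · rw [Finset.disjoint_left]
      intro d
      simp only [hD, hD₁, hD₂, Finset.mem_union, Finset.mem_filter]
      tauto
    · rw [Finset.disjoint_left]
      intro d
      simp only [hD, hD₁, Finset.mem_filter]
      tauto
  -- Around a vertex of `U` outside `B` the faces change between `T` and its complement, so some
  -- dart of `D₁` starts there.
  have hUB : #U ≤ #B + #D₁ := by
    have h : U ⊆ B ∪ D₁.image (fun d => d.fst) := by
      intro v hv
      rw [Finset.mem_union]
      by_contra! hcon
      obtain ⟨d, hd, hdT⟩ := (Finset.mem_filter.1 hv).2
      obtain ⟨e, he, heT⟩ : ∃ e : G.Dart, e.fst = v ∧ P.leftFace e ∉ T := by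
        have h := hcon.1
        rw [hB] at h
        push Not at h
        exact h
      obtain ⟨a, ha, ha1, ha2⟩ := P.exists_next_change (fun d => P.leftFace d ∈ T)
        (hd.trans he.symm) hdT heT
      refine hcon.2 (Finset.mem_image.2 ⟨a, ?_, ha.trans hd⟩)
      rw [Finset.mem_filter, P.leftFace_symm]
      exact ⟨Finset.mem_univ _, ha1, ha2⟩
    exact (Finset.card_le_card h).trans ((Finset.card_union_le _ _).trans
      (Nat.add_le_add_left Finset.card_image_le _))
  rw [hT] at h2
  omega

/-- Hall's condition, in terms of multiplicities. -/
theorem card_le_sum_multiplicity [Fintype V] [Fintype P.Face] (hG : IsLaman G) (A : Finset V) :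
    #A ≤ ∑ f ∈ P.facesAt A, P.multiplicity f := by
  classical
  induction A using Finset.strongInduction with
  | H A ih =>
  rcases A.eq_empty_or_nonempty with rfl | ⟨v₁, hv₁⟩
  · simp
  by_cases hsplit : ∃ A' ⊂ A, A'.Nonempty ∧ Disjoint (P.facesAt A') (P.facesAt (A \ A'))
  · obtain ⟨A', hA', hne, hdisj⟩ := hsplit
    have h1 := ih A' hA'
    have h2 := ih (A \ A') (Finset.sdiff_ssubset hA'.1 hne)
    have h3 : P.facesAt A' ∪ P.facesAt (A \ A') ⊆ P.facesAt A := by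
      intro f hf
      simp only [Finset.mem_union, mem_facesAt] at hf ⊢
      rcases hf with ⟨v, hv, hvf⟩ | ⟨v, hv, hvf⟩
      · exact ⟨v, hA'.1 hv, hvf⟩
      · exact ⟨v, (Finset.mem_sdiff.1 hv).1, hvf⟩
    have h4 := Finset.sum_le_sum_of_subset (f := P.multiplicity) h3
    rw [Finset.sum_union hdisj] at h4
    have h5 := Finset.card_sdiff_add_card_eq_card hA'.1
    omega
  have := hG.nontrivial
  -- Passing from `A` to `B` adds no new faces, so it suffices to bound `#B`.
  let B : Finset V := {v | ∀ d : G.Dart, d.fst = v → P.leftFace d ∈ P.facesAt A}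
  have hB : ∀ v, v ∈ B ↔ ∀ d : G.Dart, d.fst = v → P.leftFace d ∈ P.facesAt A := by simp [B]
  have hAB : A ⊆ B := fun v hv => (hB v).2 fun d hd => P.mem_facesAt.2 ⟨v, hv, d, hd, rfl⟩
  have hdart : ∀ v, ∃ d : G.Dart, d.fst = v := fun v => by
    obtain ⟨u, hu⟩ := P.connected.preconnected.exists_adj_of_nontrivial v
    exact ⟨⟨(v, u), hu⟩, rfl⟩
  choose δ hδ using hdart
  refine (Finset.card_le_card hAB).trans ?_
  by_cases hBV : ∃ v, v ∉ B
  · refine P.card_le_sum_multiplicity_of_dual_connected hG _ B hB hBV (P.leftFace (δ v₁))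
      (P.mem_facesAt.2 ⟨v₁, hv₁, δ v₁, hδ v₁, rfl⟩) fun f hf => ?_
    have hAT : ∀ v ∈ A, ∀ d : G.Dart, d.fst = v → P.leftFace d ∈ P.facesAt A :=
      fun v hv d hd => P.mem_facesAt.2 ⟨v, hv, d, hd, rfl⟩
    -- Consecutive faces around a vertex of `A` share an edge and both lie in `T`. So `f` induces a
    -- function on `A`, and a proper level set of it would split `A`.
    have hconst : ∀ v ∈ A, ∀ d : G.Dart, d.fst = v → f (P.leftFace d) = f (P.leftFace (δ v)) := by
      intro v hv d hd
      by_contra hne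
      obtain ⟨a, ha, ha1, ha2⟩ := P.exists_next_change
        (fun d => f (P.leftFace d) = f (P.leftFace (δ v))) ((hδ v).trans hd.symm) rfl hne
      rw [hδ] at ha
      apply ha2
      rw [← ha1, ← P.leftFace_symm]
      refine (hf a (hAT v hv a ha) ?_).symm
      rw [P.leftFace_symm]
      exact hAT v hv _ ((P.fst_symm_next a).trans ha)
    let A' : Finset V := {v ∈ A | f (P.leftFace (δ v)) = f (P.leftFace (δ v₁))}
    have hA' : ∀ v, v ∈ A' ↔ v ∈ A ∧ f (P.leftFace (δ v)) = f (P.leftFace (δ v₁)) := by simp [A']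
    have hAA' : A' = A := by
      by_contra hne
      refine hsplit ⟨A', (Finset.filter_subset _ _).ssubset_of_ne hne, ⟨v₁, (hA' _).2 ⟨hv₁, rfl⟩⟩,
        ?_⟩
      rw [Finset.disjoint_left]
      intro t h1 h2
      obtain ⟨v, hv, d, hd, rfl⟩ := P.mem_facesAt.1 h1
      obtain ⟨w, hw, e, he, hed⟩ := P.mem_facesAt.1 h2
      rw [hA'] at hv
      rw [Finset.mem_sdiff, hA'] at hw
      exact hw.2 ⟨hw.1, by rw [← hconst w hw.1 e he, hed, hconst v hv.1 d hd, hv.2]⟩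
    intro t ht
    obtain ⟨v, hv, d, hd, rfl⟩ := P.mem_facesAt.1 ht
    rw [hconst v hv d hd]
    exact ((hA' v).1 (hAA' ▸ hv)).2
  -- The inner edge bound fails by one here, by Euler's formula, so the global count replaces it.
  · push Not at hBV
    have hT : P.facesAt A = Finset.univ := by
      rw [Finset.eq_univ_iff_forall]
      intro t
      obtain ⟨d, rfl⟩ := P.exists_leftFace t
      exact (hB _).1 (hBV d.fst) d rfl
    rw [hT, P.sum_multiplicity hG]
    exact Finset.card_le_univ B

end PlaneGraph

/-! ### From Hall's condition to the matching and the labelling. -/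

namespace SimpleGraph

/-- A bijection between the two sides of a bipartite graph on `α ⊕ β` that joins every vertex to a
neighbour gives a perfect matching. -/
theorem exists_isPerfectMatching_of_equiv {α β : Type*} (H : SimpleGraph (α ⊕ β)) (φ : α ≃ β)
    (hφ : ∀ a, H.Adj (Sum.inl a) (Sum.inr (φ a))) : ∃ M : H.Subgraph, M.IsPerfectMatching := by
  let M : H.Subgraph :=
    { verts := Set.univ
      Adj := fun x y => ∃ a, (x = Sum.inl a ∧ y = Sum.inr (φ a)) ∨ (y = Sum.inl a ∧ x = Sum.inr (φ a))
      adj_sub := by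
        rintro x y ⟨a, ⟨rfl, rfl⟩ | ⟨rfl, rfl⟩⟩
        · exact hφ a
        · exact (hφ a).symm
      edge_vert := fun _ => Set.mem_univ _
      symm := ⟨fun x y ⟨a, h⟩ => ⟨a, h.symm⟩⟩ }
  refine ⟨M, fun v _ => ?_, fun v => Set.mem_univ v⟩
  rcases v with a | b
  · refine ⟨Sum.inr (φ a), ⟨a, Or.inl ⟨rfl, rfl⟩⟩, ?_⟩
    rintro y ⟨c, ⟨h1, rfl⟩ | ⟨_, h1⟩⟩
    · rw [Sum.inl_injective h1]
    · cases h1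
  · refine ⟨Sum.inl (φ.symm b), ⟨φ.symm b, Or.inr ⟨rfl, by simp⟩⟩, ?_⟩
    rintro y ⟨c, ⟨h1, _⟩ | ⟨rfl, h1⟩⟩
    · cases h1
    · rw [Sum.inr_injective h1, Equiv.symm_apply_apply]

end SimpleGraph

namespace PlaneGraph

variable {V : Type*} {G : SimpleGraph V} (P : PlaneGraph G)

theorem ncard_faceCopy_fst_mem [Finite V] (T : Finset P.Face) :
    {w : P.FaceCopy | w.1 ∈ T}.ncard = ∑ f ∈ T, P.multiplicity f := by
  let S : Finset P.FaceCopy := T.sigma fun f => (Finset.univ : Finset (Fin (P.multiplicity f)))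
  have h : {w : P.FaceCopy | w.1 ∈ T} = S := by
    ext w
    rw [Finset.mem_coe]
    exact ⟨fun h => Finset.mem_sigma.2 ⟨h, Finset.mem_univ _⟩, fun h => (Finset.mem_sigma.1 h).1⟩
  rw [h, Set.ncard_coe_finset]
  exact (Finset.card_sigma _ _).trans (by simp)

theorem hallCondition [Finite V] (hG : IsLaman G) : P.HallCondition := by
  classical
  have := Fintype.ofFinite V
  have := P.finite_face
  have := Fintype.ofFinite P.Face
  intro A
  have h := P.card_le_sum_multiplicity hG A.toFinset
  rw [← P.ncard_faceCopy_fst_mem, ← Set.ncard_eq_toFinset_card'] at h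
  have hA : {w : P.FaceCopy | ∃ v ∈ A, P.bipartiteGraph.Adj (Sum.inl v) (Sum.inr w)}
      = {w : P.FaceCopy | w.1 ∈ P.facesAt A.toFinset} := by
    ext w
    refine Iff.trans ?_ P.mem_facesAt.symm
    simp only [Set.mem_toFinset]
    rfl
  rwa [hA]

theorem finite_faceCopy [Finite V] : Finite P.FaceCopy :=
  have := P.finite_face
  inferInstanceAs (Finite (Σ f : P.Face, Fin (P.multiplicity f)))

theorem card_faceCopy [Finite V] (hG : IsLaman G) : Nat.card P.FaceCopy = Nat.card V := by
  have := Fintype.ofFinite V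
  have := P.finite_face
  have := Fintype.ofFinite P.Face
  rw [Nat.card_eq_fintype_card (α := V), ← P.sum_multiplicity hG, ← P.ncard_faceCopy_fst_mem,
    ← Set.ncard_univ]
  simp

theorem exists_equiv_faceCopy [Finite V] (hG : IsLaman G) :
    ∃ φ : V ≃ P.FaceCopy, ∀ v, P.OnFace v (φ v).1 := by
  classical
  have := Fintype.ofFinite V
  have := P.finite_faceCopy
  have := Fintype.ofFinite P.FaceCopy
  obtain ⟨φ, hφ, hφ'⟩ := (Fintype.all_card_le_filter_rel_iff_exists_injective
    fun (v : V) (w : P.FaceCopy) => P.OnFace v w.1).1 fun A => by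
      have h := P.hallCondition hG A
      rw [Set.ncard_coe_finset, Set.ncard_eq_toFinset_card'] at h
      convert h
      ext w
      simp only [Finset.mem_filter, Finset.mem_univ, true_and, Set.mem_toFinset]
      rfl
  have hcard := P.card_faceCopy hG
  rw [Nat.card_eq_fintype_card, Nat.card_eq_fintype_card] at hcard
  exact ⟨Equiv.ofBijective φ ((Fintype.bijective_iff_injective_and_card φ).2 ⟨hφ, hcard.symm⟩), hφ'⟩

theorem ncard_faceCopy_fst_eq [Finite V] (f : P.Face) :
    {w : P.FaceCopy | w.1 = f}.ncard = P.multiplicity f := by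
  simpa using P.ncard_faceCopy_fst_mem {f}

/-- A bijection that assigns to every vertex a copy of one of its faces gives a pointed
combinatorial pseudo-triangulation. -/
theorem exists_isPointedCPT_of_equiv [Finite V] (φ : V ≃ P.FaceCopy)
    (hφ : ∀ v, P.OnFace v (φ v).1) : ∃ Big : Set P.Angle, P.IsPointedCPT Big := by
  have hfin : Finite G.Dart := Finite.of_injective _ SimpleGraph.Dart.toProd_injective
  -- A vertex may have several angles in its assigned face; any one of them serves as its big angle.
  choose ang hang hface using hφ
  have hinj : Function.Injective ang := fun v w h => by rw [← hang v, ← hang w, h]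
  have hpointed : ∀ v : V, ∃ a ∈ Set.range ang, Angle.vertex (P := P) a = v :=
    fun v => ⟨ang v, ⟨v, rfl⟩, hang v⟩
  have hbig : ∀ f : P.Face, {a : G.Dart | P.leftFace a = f ∧ a ∈ Set.range ang}.ncard
      = P.multiplicity f := by
    intro f
    have h : {a : G.Dart | P.leftFace a = f ∧ a ∈ Set.range ang}
        = (ang ∘ φ.symm) '' {w : P.FaceCopy | w.1 = f} := by
      ext a
      constructor
      · rintro ⟨h1, v, rfl⟩
        exact ⟨φ v, (hface v).symm.trans h1, by simp⟩
      · rintro ⟨w, hw, rfl⟩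
        refine ⟨(hface _).trans ?_, ⟨_, rfl⟩⟩
        rw [φ.apply_symm_apply]
        exact hw
    rw [h, Set.ncard_image_of_injective _ (hinj.comp φ.symm.injective), P.ncard_faceCopy_fst_eq]
  -- All copies of `f` are matched, so the small angles number 3 in an interior face and 0 in the
  -- outer one.
  have hsmall : ∀ f : P.Face, {a : G.Dart | P.leftFace a = f ∧ a ∉ Set.range ang}.ncard
      + P.multiplicity f = P.faceDegree f := by
    intro f
    have h := Set.ncard_inter_add_ncard_sdiff_eq_ncard {a : G.Dart | P.leftFace a = f}
      (Set.range ang) (Set.toFinite _)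
    rw [← hbig f, RotationSystem.faceDegree, ← h, add_comm]
    rfl
  refine ⟨Set.range ang, ⟨?_, ?_, ?_, fun v _ => hpointed v, fun v _ => hpointed v⟩, hpointed⟩
  · intro f hf
    have h1 := hsmall f
    have h2 := P.multiplicity_add_three f
    rw [if_neg hf] at h2
    change {a : G.Dart | P.leftFace a = f ∧ a ∉ Set.range ang}.ncard = 3
    omega
  · intro a ha
    by_contra hcon
    have h1 := hsmall P.outer
    have h2 := P.multiplicity_add_three P.outer
    rw [if_pos rfl] at h2
    have h3 : {a : G.Dart | P.leftFace a = P.outer ∧ a ∉ Set.range ang}.ncard = 0 := by omega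
    rw [Set.ncard_eq_zero] at h3
    exact Set.eq_empty_iff_forall_notMem.1 h3 a ⟨ha, hcon⟩
  · rintro _ ⟨v, rfl⟩ _ ⟨w, rfl⟩ h
    have h' : v = w := (hang v).symm.trans (Eq.trans h (hang w))
    rw [h']

end PlaneGraph

theorem mainTheorem8 {V : Type*} [Finite V] (G : SimpleGraph V) (P : PlaneGraph G)
    (hG : IsLaman G) :
    P.HallCondition ∧
      (∃ M : P.bipartiteGraph.Subgraph, M.IsPerfectMatching) ∧
      ∃ Big : Set P.Angle, P.IsPointedCPT Big := by
  obtain ⟨φ, hφ⟩ := P.exists_equiv_faceCopy hG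
  exact ⟨P.hallCondition hG, P.bipartiteGraph.exists_isPerfectMatching_of_equiv φ hφ,
    P.exists_isPointedCPT_of_equiv φ hφ⟩
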